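/- Theorem 2. Let $1\le m\le n$ and let $D\subset\mathbb C^n$ be a domain (a non-empty connected open set). If $E_1,E_2,\dots\subset D$ is a countable family of $m$-polar subsets of $D$, then $E=\bigcup_j E_j$ is $m$-polar in $D$. Here $d^c=\frac{\partial-\bar\partial}{4i}$, $\beta=dd^c|z|^2$, and the following definitions are used. A function $v\in C^2(D)$ is $m$-subharmonic if $(dd^cv)^k\wedge\beta^{n-k}\ge0$ in $D$ for every $k=1,\dots,m$. A function $u:D\to[-\infty,\infty)$ is $m$-subharmonic in $D$, written $u\in sh_m(D)$, if it is upper semicontinuous, belongs to $L^1_{loc}(D)$ (so it is finite almost everywhere), and for all $m$-subharmonic $v_1,\dots,v_{m-1}\in C^2(D)$ the current $dd^cu\wedge dd^cv_1\wedge\dots\wedge dd^cv_{m-1}\wedge\beta^{n-m}$ is positive, i.e. $$\int_D u\;dd^cv_1\wedge\dots\wedge dd^cv_{m-1}\wedge\beta^{n-m}\wedge dd^c\omega\;\ge\;0$$ for every non-negative $\omega\in C_c^\infty(D)$. A set $E\subset D$ is $m$-polar in $D$ if there is $u\in sh_m(D)$, $u\not\equiv-\infty$, with $u=-\infty$ at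 every point of $E$. -/

import Mathlib

namespace ComplexHessian

noncomputable section

/-- The space `ℂⁿ`. Its underlying real vector space has dimension `2 n`, and `volume` on it is
Lebesgue measure. -/
abbrev Cn (n : ℕ) : Type := Fin n → ℂ

/-- Real alternating `k`-forms (with constant coefficients) on `ℂⁿ`. -/
abbrev KForm (n k : ℕ) : Type := Cn n [⋀^Fin k]→ₗ[ℝ] ℝ

/-- The wedge product of two real alternating forms: the signed sum over shuffles, with the
normalization `(dx ∧ dy)(e₁, e₂) = 1`. -/
def wedge {n k l : ℕ} (a : KForm n k) (b : KForm n l) : KForm n (k + l) :=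
  ((LinearMap.mul' ℝ ℝ).compAlternatingMap (a.domCoprod b)).domDomCongr finSumFinEquiv

/-- The product `φ₀ ∧ φ₁ ∧ ⋯ ∧ φₖ₋₁` of `k` two-forms; the empty product is the `0`-form `1`. -/
def wedgeProd {n : ℕ} : {k : ℕ} → (Fin k → KForm n 2) → KForm n (2 * k)
  | 0, _ => AlternatingMap.constOfIsEmpty ℝ (Cn n) (Fin 0) (1 : ℝ)
  | _ + 1, φ => wedge (wedgeProd fun i => φ i.castSucc) (φ (Fin.last _))

/-- The power `φ ∧ ⋯ ∧ φ` (`k` factors) of a two-form. -/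
def wedgePow {n : ℕ} (φ : KForm n 2) (k : ℕ) : KForm n (2 * k) :=
  wedgeProd fun _ : Fin k => φ

/-- The positively oriented real basis `e₁, i e₁, e₂, i e₂, …, eₙ, i eₙ` of `ℂⁿ`. -/
def stdFrame (n : ℕ) (i : Fin (2 * n)) : Cn n :=
  Pi.single ⟨i.1 / 2, by omega⟩ (if i.1 % 2 = 0 then 1 else Complex.I)

/-- The coefficient of a form of top degree `2 n` with respect to the Lebesgue volume form
`dx₁ ∧ dy₁ ∧ ⋯ ∧ dxₙ ∧ dyₙ`. -/
def topCoeff {n k : ℕ} (h : k = 2 * n) (φ : KForm n k) : ℝ :=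
  φ fun i => stdFrame n (Fin.cast h i)

/-- The operator `d^c = (∂ - ∂̄) / (4 i)` on real functions. Since
`∂ u (X) = (d u (X) - i d u (i X)) / 2` and `∂̄ u (X) = (d u (X) + i d u (i X)) / 2`,
it is `d^c u (X) = - d u (i X) / 4`. -/
def dc {n : ℕ} (u : Cn n → ℝ) (z : Cn n) : Cn n [⋀^Fin 1]→L[ℝ] ℝ :=
  ContinuousAlternatingMap.ofSubsingleton ℝ (Cn n) ℝ (0 : Fin 1)
    ((-(1 / 4) : ℝ) • (fderiv ℝ u z).comp (Complex.I • ContinuousLinearMap.id ℝ (Cn n)))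

/-- The real two-form `d d^c u` at the point `z`. -/
def ddc {n : ℕ} (u : Cn n → ℝ) (z : Cn n) : KForm n 2 :=
  (extDeriv (dc u) z).toAlternatingMap

/-- The form `β = d d^c |z|²`. -/
def beta (n : ℕ) (z : Cn n) : KForm n 2 :=
  ddc (fun w : Cn n => ∑ j, ‖w j‖ ^ 2) z

/-- `v` is a twice continuously differentiable `m`-subharmonic function in the open set
`D ⊆ ℂⁿ`: `(d d^c v)^k ∧ β^(n - k) ≥ 0` in `D` for `k = 1, …, m`. -/
structure IsC2MSubharmonic {n m : ℕ} (hmn : m ≤ n) (D : Set (Cn n)) (v : Cn n → ℝ) : Prop where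
  contDiffOn : ContDiffOn ℝ 2 v D
  nonneg : ∀ (k : ℕ) (_ : 1 ≤ k) (hkm : k ≤ m), ∀ z ∈ D,
    0 ≤ topCoeff (by omega : 2 * k + 2 * (n - k) = 2 * n)
      (wedge (wedgePow (ddc v z) k) (wedgePow (beta n z) (n - k)))

/-- The coefficient, with respect to the Lebesgue volume form, of
`d d^c v₁ ∧ ⋯ ∧ d d^c vₘ₋₁ ∧ β^(n - m) ∧ d d^c ω` at the point `z`. -/
def pairingDensity {n m : ℕ} (hm : 1 ≤ m) (hmn : m ≤ n) (v : Fin (m - 1) → Cn n → ℝ)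
    (ω : Cn n → ℝ) (z : Cn n) : ℝ :=
  topCoeff (by omega : 2 * (m - 1) + 2 * (n - m) + 2 = 2 * n)
    (wedge (wedge (wedgeProd fun i => ddc (v i) z) (wedgePow (beta n z) (n - m))) (ddc ω z))

/-- `u : D → [-∞, ∞)` is `m`-subharmonic in the open set `D ⊆ ℂⁿ`: it is locally integrable
(in particular finite almost everywhere), upper semicontinuous, and for all
`C²` functions `v₁, …, vₘ₋₁` that are `m`-subharmonic in `D` the current
`d d^c u ∧ d d^c v₁ ∧ ⋯ ∧ d d^c vₘ₋₁ ∧ β^(n - m)` is positive. Only the values of `u` on `D`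
matter. -/
structure IsMSubharmonic {n m : ℕ} (hm : 1 ≤ m) (hmn : m ≤ n) (D : Set (Cn n))
    (u : Cn n → EReal) : Prop where
  ne_top : ∀ z ∈ D, u z ≠ ⊤
  upperSemicontinuousOn : UpperSemicontinuousOn u D
  ae_ne_bot : ∀ᵐ z ∂(MeasureTheory.volume.restrict D), u z ≠ ⊥
  locallyIntegrableOn :
    MeasureTheory.LocallyIntegrableOn (fun z => (u z).toReal) D MeasureTheory.volume
  current_nonneg : ∀ v : Fin (m - 1) → Cn n → ℝ, (∀ i, IsC2MSubharmonic hmn D (v i)) →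
    ∀ ω : Cn n → ℝ, ContDiff ℝ ((⊤ : ℕ∞) : WithTop ℕ∞) ω → HasCompactSupport ω → tsupport ω ⊆ D → (∀ z, 0 ≤ ω z) →
      0 ≤ ∫ z in D, (u z).toReal * pairingDensity hm hmn v ω z

/-- `E` is an `m`-polar subset of `D`: it is contained in `D`, and some `u ∈ sh_m(D)` that is not
identically `-∞` equals `-∞` on `E`. -/
def IsMPolar {n m : ℕ} (hm : 1 ≤ m) (hmn : m ≤ n) (D E : Set (Cn n)) : Prop :=
  E ⊆ D ∧ ∃ u : Cn n → EReal, IsMSubharmonic hm hmn D u ∧ (∃ z ∈ D, u z ≠ ⊥) ∧ ∀ z ∈ E, u z = ⊥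

end

end ComplexHessian

/-!
A scaled sum of the functions `u j` defining the sets `E j` is `-∞` on their union. Let `K j` be
compact sets exhausting `D`. Since `u j` is upper semicontinuous and locally integrable, some
`c j > 0` makes both `c j * u j` on `K j` and the integral of `|c j * u j|` over `K j` at most
`2⁻ʲ` (`IsMSubharmonic.exists_const_mul_le`). The sum `u = ∑ c j * u j` is then `m`-subharmonic
(`isMSubharmonic_erealSeries`):

* near each point of `D` all but finitely many terms are at most `2⁻ʲ`, so that the partial sums,
  corrected by the geometric tail `∑_{j ≥ N} 2⁻ʲ = 2 * 2⁻ᴺ`, are eventually decreasing in `N`, and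
  their limit is upper semicontinuous (`erealSeries_eq_iInf`);
* the series converges in `L¹` on every compact subset of `D`, so that `u` is finite almost
  everywhere and locally integrable (`ae_summable_and_integrable_tsum`);
* the density of `d d^c v₁ ∧ ⋯ ∧ d d^c vₘ₋₁ ∧ β^(n - m) ∧ d d^c ω` is continuous on `D` and vanishes
  off the compact support of `ω` (`continuousOn_pairingDensity`), so that integrating against it
  commutes with the sum, and a sum of non-negative numbers is non-negative.

The smallness of the `L¹` norms replaces the usual choice of a point at which all `u j` are finite:
`u` is finite almost everywhere in `D`, hence not identically `-∞`.

The correction by constants takes place only in the study of semicontinuity. Subtracting constants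
from the `u j` themselves would require constants to be `m`-subharmonic, which is Stokes' theorem
for the currents `d d^c v₁ ∧ ⋯ ∧ d d^c vₘ₋₁ ∧ β^(n - m)` with `vᵢ` merely `C²`.
-/

namespace ComplexHessian

open MeasureTheory Filter Topology Set

/-! ### Continuity of the pairing density -/

/-- Continuity of a family of forms is stated through its values on fixed vectors, since `KForm`
carries no topology. -/
theorem continuousOn_wedge {X : Type*} [TopologicalSpace X] {s : Set X} {n k l : ℕ}
    {a : X → KForm n k} {b : X → KForm n l}
    (ha : ∀ v, ContinuousOn (fun z => a z v) s) (hb : ∀ v, ContinuousOn (fun z => b z v) s)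
    (v : Fin (k + l) → Cn n) : ContinuousOn (fun z => wedge (a z) (b z) v) s := by
  simp only [wedge, AlternatingMap.domDomCongr_apply, LinearMap.compAlternatingMap_apply,
    AlternatingMap.domCoprod_apply, sum_apply, map_sum]
  refine continuousOn_finsetSum _ fun σ _ => ?_
  induction σ using Quotient.inductionOn' with | _ σ
  have (z : X) : LinearMap.mul' ℝ ℝ (AlternatingMap.domCoprod.summand (a z) (b z)
        (Quotient.mk'' σ) fun i => v (finSumFinEquiv i)) =
      ((Equiv.Perm.sign σ : ℤ) : ℝ) *
        (a z (fun i => v (finSumFinEquiv (σ (Sum.inl i)))) *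
          b z (fun i => v (finSumFinEquiv (σ (Sum.inr i))))) := by
    rw [AlternatingMap.domCoprod.summand_mk'', Units.smul_def, smul_apply, map_zsmul,
      zsmul_eq_mul]
    rfl
  exact (continuousOn_const.mul ((ha _).mul (hb _))).congr fun z _ => this z

theorem continuousOn_wedgeProd {X : Type*} [TopologicalSpace X] {s : Set X} {n : ℕ} :
    ∀ {k : ℕ} {φ : X → Fin k → KForm n 2},
      (∀ i v, ContinuousOn (fun z => φ z i v) s) →
      ∀ v, ContinuousOn (fun z => wedgeProd (φ z) v) s
  | 0, _, _, _ => continuousOn_const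
  | _ + 1, _, hφ, v =>
    continuousOn_wedge (continuousOn_wedgeProd fun i => hφ i.castSucc) (hφ (Fin.last _)) v

theorem wedge_zero {n k l : ℕ} (a : KForm n k) : wedge a (0 : KForm n l) = 0 := by
  have h : a.domCoprod (0 : KForm n l) = 0 :=
    map_zero (AlternatingMap.domCoprod' (R' := ℝ) ∘ₗ TensorProduct.mk ℝ _ (KForm n l) a)
  ext v
  simp [wedge, h]

theorem continuousOn_ddc {n : ℕ} {D : Set (Cn n)} (hD : IsOpen D) {v : Cn n → ℝ}
    (hv : ContDiffOn ℝ 2 v D) (x : Fin 2 → Cn n) : ContinuousOn (fun z => ddc v z x) D := by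
  have h1 : ContDiffOn ℝ 1 (fderiv ℝ v) D := hv.fderiv_of_isOpen hD (by norm_num)
  have h2 : ContDiffOn ℝ 1 (dc v) D := by
    have hlin : ContDiff ℝ 1 fun f : Cn n →L[ℝ] ℝ =>
        ContinuousAlternatingMap.ofSubsingletonLIE (𝕜 := ℝ) (E := Cn n) (F := ℝ) (0 : Fin 1)
          ((-(1 / 4) : ℝ) • f.comp (Complex.I • ContinuousLinearMap.id ℝ (Cn n))) := by
      fun_prop
    exact hlin.comp_contDiffOn h1
  have h3 : ContinuousOn (fderiv ℝ (dc v)) D := h2.continuousOn_fderiv_of_isOpen hD le_rfl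
  have h4 : Continuous fun f : Cn n →L[ℝ] (Cn n [⋀^Fin 1]→L[ℝ] ℝ) =>
      (ContinuousAlternatingMap.alternatizeUncurryFin f) x := by
    have := (ContinuousAlternatingMap.alternatizeUncurryFinCLM ℝ (Cn n) ℝ (n := 1)).continuous
    exact (ContinuousAlternatingMap.apply ℝ (Cn n) ℝ x).continuous.comp this
  exact h4.comp_continuousOn h3

theorem ddc_eq_zero_of_notMem_tsupport {n : ℕ} {v : Cn n → ℝ} {z : Cn n} (hz : z ∉ tsupport v) :
    ddc v z = 0 := by
  have h0 : dc v =ᶠ[𝓝 z] fun _ => 0 := by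
    filter_upwards [(isClosed_tsupport v).isOpen_compl.mem_nhds hz] with w hw
    have h : fderiv ℝ v w = 0 := by
      by_contra hne
      exact hw (support_fderiv_subset ℝ (Function.mem_support.mpr hne))
    ext x
    simp [dc, h]
  have h1 : fderiv ℝ (dc v) z = 0 := by rw [h0.fderiv_eq]; simp
  ext x
  simp [ddc, extDeriv, h1, ContinuousAlternatingMap.alternatizeUncurryFin_apply]

theorem continuousOn_pairingDensity {n m : ℕ} (hm : 1 ≤ m) (hmn : m ≤ n) {D : Set (Cn n)}
    (hD : IsOpen D) {v : Fin (m - 1) → Cn n → ℝ} (hv : ∀ i, ContDiffOn ℝ 2 (v i) D)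
    {ω : Cn n → ℝ} (hω : ContDiffOn ℝ 2 ω D) :
    ContinuousOn (pairingDensity hm hmn v ω) D := by
  have hβ : ContDiff ℝ 2 fun w : Cn n => ∑ j, ‖w j‖ ^ 2 :=
    ContDiff.sum fun j _ => (contDiff_apply ℝ ℂ j).norm_sq ℝ
  exact continuousOn_wedge (continuousOn_wedge
    (continuousOn_wedgeProd fun i => continuousOn_ddc hD (hv i))
    (continuousOn_wedgeProd fun _ => continuousOn_ddc hD hβ.contDiffOn))
    (continuousOn_ddc hD hω) _

theorem pairingDensity_eq_zero_of_notMem_tsupport {n m : ℕ} (hm : 1 ≤ m) (hmn : m ≤ n)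
    (v : Fin (m - 1) → Cn n → ℝ) {ω : Cn n → ℝ} {z : Cn n} (hz : z ∉ tsupport ω) :
    pairingDensity hm hmn v ω z = 0 := by
  simp [pairingDensity, topCoeff, ddc_eq_zero_of_notMem_tsupport hz, wedge_zero]

/-! ### Series of integrable and of extended real functions -/

/-- A series that converges absolutely in `L¹` converges almost everywhere, to an integrable
function. -/
theorem ae_summable_and_integrable_tsum {α : Type*} [MeasurableSpace α] {μ : Measure α}
    {F : ℕ → α → ℝ} (hF : ∀ i, Integrable (F i) μ) (hsum : Summable fun i => ∫ a, ‖F i a‖ ∂μ) :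
    (∀ᵐ a ∂μ, Summable fun i => F i a) ∧ Integrable (fun a => ∑' i, F i a) μ := by
  have hfin : ∫⁻ a, ∑' i, ‖F i a‖ₑ ∂μ ≠ ⊤ := by
    rw [lintegral_tsum fun i => (hF i).1.enorm]
    simp_rw [← ofReal_integral_norm_eq_lintegral_enorm (hF _)]
    exact hsum.tsum_ofReal_ne_top
  have hmeas : AEMeasurable (fun a => ∑' i, ‖F i a‖ₑ) μ :=
    AEMeasurable.tsum fun i => (hF i).1.enorm
  have hae : ∀ᵐ a ∂μ, Summable fun i => F i a := by
    filter_upwards [ae_lt_top' hmeas hfin] with a ha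
    have h : Summable fun i => ‖F i a‖₊ := ENNReal.tsum_coe_ne_top_iff_summable.mp ha.ne
    exact .of_norm (NNReal.summable_coe.mpr h)
  refine ⟨hae, ⟨?_, ?_⟩⟩
  · refine aestronglyMeasurable_of_tendsto_ae atTop
      (f := fun N a => ∑ i ∈ Finset.range N, F i a)
      (fun N => Finset.aestronglyMeasurable_fun_sum _ fun i _ => (hF i).1) ?_
    filter_upwards [hae] with a ha using ha.hasSum.tendsto_sum_nat
  · refine lt_of_le_of_lt (lintegral_mono_ae ?_) hfin.lt_top
    filter_upwards [hae] with a ha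
    exact enorm_tsum_le_tsum_enorm

theorem upperSemicontinuousOn_sum_ereal {X : Type*} [TopologicalSpace X] {s : Set X}
    {f : ℕ → X → EReal} (hf : ∀ j, UpperSemicontinuousOn (f j) s)
    (htop : ∀ j, ∀ z ∈ s, f j z ≠ ⊤) (N : ℕ) :
    UpperSemicontinuousOn (fun z => ∑ j ∈ Finset.range N, f j z) s ∧
      ∀ z ∈ s, ∑ j ∈ Finset.range N, f j z ≠ ⊤ := by
  induction N with
  | zero => exact ⟨by simpa using upperSemicontinuousOn_const, by simp⟩
  | succ N ih =>
    simp only [Finset.sum_range_succ]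
    exact ⟨ih.1.add' (hf N) fun z hz =>
        EReal.continuousAt_add (.inl (ih.2 z hz)) (.inr (htop N z hz)),
      fun z hz => EReal.add_ne_top (ih.2 z hz) (htop N z hz)⟩

/-- The sum of a series of extended real numbers, encoded as the upper limit of its partial sums.
The `N`-th partial sum is corrected by `2 * 2⁻ᴺ = ∑_{j ≥ N} 2⁻ʲ`; this does not change the limit and
makes the sequence eventually decreasing as soon as the terms satisfy `a j ≤ 2⁻ʲ` eventually. -/
noncomputable def erealSeries (a : ℕ → EReal) : EReal :=
  limsup (fun N => ∑ j ∈ Finset.range N, a j + ((2 * (1 / 2) ^ N : ℝ) : EReal)) atTop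

theorem erealSeries_eq_iInf {a : ℕ → EReal} {k : ℕ}
    (ha : ∀ j, k ≤ j → a j ≤ (((1 / 2) ^ j : ℝ) : EReal)) :
    erealSeries a =
      ⨅ N : ℕ, (∑ j ∈ Finset.range (N + k), a j + ((2 * (1 / 2) ^ (N + k) : ℝ) : EReal)) := by
  rw [erealSeries, ← limsup_nat_add _ k]
  -- The step from `N` to `N + 1` adds `a N ≤ 2⁻ᴺ` and lowers the correction by exactly `2⁻ᴺ`.
  refine (tendsto_atTop_iInf (antitone_nat_of_succ_le fun N => ?_)).limsup_eq
  rw [show N + 1 + k = (N + k) + 1 by ring, Finset.sum_range_succ, add_assoc]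
  gcongr
  refine (add_le_add_left (ha (N + k) (by omega)) _).trans ?_
  rw [← EReal.coe_add, EReal.coe_le_coe_iff, pow_succ]
  linarith

theorem erealSeries_eq_bot {a : ℕ → EReal} {j : ℕ} (hj : a j = ⊥) : erealSeries a = ⊥ := by
  refine (tendsto_const_nhds.congr' ?_).limsup_eq
  filter_upwards [eventually_gt_atTop j] with N hN
  rw [← Finset.add_sum_erase _ _ (Finset.mem_range.mpr hN), hj, EReal.bot_add, EReal.bot_add]

theorem erealSeries_eq_tsum {a : ℕ → EReal} (hbot : ∀ j, a j ≠ ⊥) (htop : ∀ j, a j ≠ ⊤)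
    (hsum : Summable fun j => (a j).toReal) :
    erealSeries a = ((∑' j, (a j).toReal : ℝ) : EReal) := by
  have hpow : Tendsto (fun N : ℕ => (2 * (1 / 2) ^ N : ℝ)) atTop (𝓝 0) := by
    simpa using (tendsto_pow_atTop_nhds_zero_of_lt_one (r := (1 / 2 : ℝ))
      (by norm_num) (by norm_num)).const_mul 2
  have hlim := hsum.hasSum.tendsto_sum_nat.add hpow
  rw [add_zero] at hlim
  refine ((continuous_coe_real_ereal.tendsto _).comp hlim |>.congr fun N => ?_).limsup_eq
  have (N : ℕ) : ∑ j ∈ Finset.range N, a j =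
      ((∑ j ∈ Finset.range N, (a j).toReal : ℝ) : EReal) := by
    induction N with
    | zero => simp
    | succ N ih =>
      rw [Finset.sum_range_succ, Finset.sum_range_succ, ih, EReal.coe_add,
        EReal.coe_toReal (htop N) (hbot N)]
  simp only [Function.comp, this, EReal.coe_add]

/-! ### Operations on `m`-subharmonic functions -/

variable {n m : ℕ} {hm : 1 ≤ m} {hmn : m ≤ n} {D : Set (Cn n)}

theorem isMSubharmonic_zero : IsMSubharmonic hm hmn D (fun _ => 0) where
  ne_top := by simp
  upperSemicontinuousOn := upperSemicontinuousOn_const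
  ae_ne_bot := by simp
  locallyIntegrableOn := by simpa using (locallyIntegrable_zero (μ := volume)).locallyIntegrableOn D
  current_nonneg := by simp

theorem IsMSubharmonic.const_mul {u : Cn n → EReal} (hu : IsMSubharmonic hm hmn D u) {c : ℝ}
    (hc : 0 < c) : IsMSubharmonic hm hmn D (fun z => (c : EReal) * u z) where
  ne_top z hz := by
    have h := hu.ne_top z hz
    induction hx : u z with
    | bot => simp [EReal.coe_mul_bot_of_pos hc]
    | top => exact absurd hx h
    | coe x => rw [← EReal.coe_mul]; exact EReal.coe_ne_top _
  upperSemicontinuousOn := by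
    have hcont : Continuous fun x : EReal => (c : EReal) * x := by
      refine continuous_iff_continuousAt.mpr fun x => ?_
      have hc0 : (c : EReal) ≠ 0 := by exact_mod_cast hc.ne'
      exact (EReal.continuousAt_mul (p := ((c : EReal), x)) (.inl hc0) (.inl hc0)
        (.inl (EReal.coe_ne_bot c)) (.inl (EReal.coe_ne_top c))).comp
        (f := fun x : EReal => ((c : EReal), x)) (by fun_prop)
    refine hcont.comp_upperSemicontinuousOn hu.upperSemicontinuousOn fun x y hxy => ?_
    exact mul_le_mul_of_nonneg_left hxy (EReal.coe_nonneg.mpr hc.le)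
  ae_ne_bot := by
    filter_upwards [hu.ae_ne_bot] with z hz
    induction hx : u z with
    | bot => exact absurd hx hz
    | top => simp [EReal.coe_mul_top_of_pos hc]
    | coe x => rw [← EReal.coe_mul]; exact EReal.coe_ne_bot _
  locallyIntegrableOn := by
    simp only [EReal.toReal_mul, EReal.toReal_coe]
    intro z hz
    obtain ⟨s, hs, hint⟩ := hu.locallyIntegrableOn z hz
    exact ⟨s, hs, hint.const_mul c⟩
  current_nonneg v hv ω h1 h2 h3 h4 := by
    simp only [EReal.toReal_mul, EReal.toReal_coe, mul_assoc, integral_const_mul]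
    exact mul_nonneg hc.le (hu.current_nonneg v hv ω h1 h2 h3 h4)

theorem ae_erealSeries_eq_tsum {u : ℕ → Cn n → EReal} (hD : IsOpen D)
    (hu : ∀ j, IsMSubharmonic hm hmn D (u j))
    (hsum : ∀ L ⊆ D, IsCompact L → Summable fun j => ∫ z in L, ‖(u j z).toReal‖) :
    ∀ᵐ z ∂volume.restrict D, erealSeries (fun j => u j z) =
      ((∑' j, (u j z).toReal : ℝ) : EReal) := by
  have hsumm : ∀ᵐ z ∂volume.restrict D, Summable fun j => (u j z).toReal := by
    rw [ae_restrict_iff' hD.measurableSet, ae_iff]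
    -- The terms are summable in `L¹` only over compact sets, so the exceptional set is shown to be
    -- null near each of its points.
    refine measure_null_of_locally_null _ fun x hx => ?_
    have hxD : x ∈ D := by by_contra h; exact hx fun h' => absurd h' h
    obtain ⟨L, hL, hLD, hLc⟩ := local_compact_nhds (hD.mem_nhds hxD)
    have hae := (ae_summable_and_integrable_tsum (μ := volume.restrict L)
      (fun j => (hu j).locallyIntegrableOn.integrableOn_compact_subset hLD hLc)
      (hsum L hLD hLc)).1
    rw [ae_restrict_iff' hLc.measurableSet, ae_iff] at hae
    refine ⟨_ ∩ L, inter_mem_nhdsWithin _ hL, measure_mono_null ?_ hae⟩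
    exact fun z hz h => hz.1 fun _ => h hz.2
  filter_upwards [hsumm, ae_all_iff.mpr fun j => (hu j).ae_ne_bot,
    ae_restrict_mem hD.measurableSet] with z hz hbot hzD
  exact erealSeries_eq_tsum hbot (fun j => (hu j).ne_top z hzD) hz

/-- A series of `m`-subharmonic functions that converges in `L¹` on compact sets, with terms
eventually at most `2⁻ʲ` on each compact set, has an `m`-subharmonic sum. -/
theorem isMSubharmonic_erealSeries {u : ℕ → Cn n → EReal} (hD : IsOpen D)
    (hu : ∀ j, IsMSubharmonic hm hmn D (u j))
    (hsum : ∀ L ⊆ D, IsCompact L → Summable fun j => ∫ z in L, ‖(u j z).toReal‖)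
    (hle : ∀ L ⊆ D, IsCompact L → ∀ᶠ j in atTop, ∀ z ∈ L, u j z ≤ (((1 / 2) ^ j : ℝ) : EReal)) :
    IsMSubharmonic hm hmn D (fun z => erealSeries fun j => u j z) := by
  have hint (j : ℕ) {L : Set (Cn n)} (hLD : L ⊆ D) (hL : IsCompact L) :
      IntegrableOn (fun z => (u j z).toReal) L :=
    (hu j).locallyIntegrableOn.integrableOn_compact_subset hLD hL
  have hae := ae_erealSeries_eq_tsum hD hu hsum
  have husc (N : ℕ) := upperSemicontinuousOn_sum_ereal (fun j => (hu j).upperSemicontinuousOn)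
    (fun j => (hu j).ne_top) N
  -- Near each point the sum is an infimum of upper semicontinuous functions.
  have hlocal (z : Cn n) (hz : z ∈ D) : ∃ L ∈ 𝓝 z, L ⊆ D ∧ ∃ k : ℕ, ∀ w ∈ L,
      erealSeries (fun j => u j w) = ⨅ N : ℕ, (∑ j ∈ Finset.range (N + k), u j w +
        ((2 * (1 / 2) ^ (N + k) : ℝ) : EReal)) := by
    obtain ⟨L, hLz, hLD, hL⟩ := local_compact_nhds (hD.mem_nhds hz)
    obtain ⟨k, hk⟩ := eventually_atTop.mp (hle L hLD hL)
    exact ⟨L, hLz, hLD, k, fun w hw => erealSeries_eq_iInf fun j hj => hk j hj w hw⟩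
  refine ⟨fun z hz => ?_, fun z hz => ?_, ?_, fun z hz => ?_, fun v hv ω h1 h2 h3 h4 => ?_⟩
  · obtain ⟨L, hLz, hLD, k, hk⟩ := hlocal z hz
    rw [hk z (mem_of_mem_nhds hLz)]
    refine (iInf_lt_iff.mpr ⟨0, ?_⟩).ne
    exact EReal.add_lt_top ((husc (0 + k)).2 z hz) (EReal.coe_ne_top _)
  · obtain ⟨L, hLz, hLD, k, hk⟩ := hlocal z hz
    have h : UpperSemicontinuousOn (fun w => ⨅ N : ℕ, (∑ j ∈ Finset.range (N + k), u j w +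
        ((2 * (1 / 2) ^ (N + k) : ℝ) : EReal))) D :=
      upperSemicontinuousOn_iInf fun N => (husc (N + k)).1.add' upperSemicontinuousOn_const
        fun w hw => EReal.continuousAt_add (.inr (EReal.coe_ne_bot _)) (.inr (EReal.coe_ne_top _))
    intro y hy
    simp only [hk z (mem_of_mem_nhds hLz)] at hy
    filter_upwards [h z hz y hy, mem_nhdsWithin_of_mem_nhds hLz] with w hw hwL
    rwa [hk w hwL]
  · filter_upwards [hae] with z hz
    rw [hz]
    exact EReal.coe_ne_bot _
  · obtain ⟨L, hLz, hLD, hL⟩ := local_compact_nhds (hD.mem_nhds hz)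
    refine ⟨L, mem_nhdsWithin_of_mem_nhds hLz, ?_⟩
    refine (ae_summable_and_integrable_tsum (fun j => hint j hLD hL) (hsum L hLD hL)).2.congr ?_
    filter_upwards [ae_restrict_of_ae_restrict_of_subset hLD hae] with z hz
    rw [hz, EReal.toReal_coe]
  · set p := pairingDensity hm hmn v ω
    have hp : ContinuousOn p (tsupport ω) := (continuousOn_pairingDensity hm hmn hD
      (fun i => (hv i).contDiffOn) (contDiff_infty.mp h1 2).contDiffOn).mono h3
    have hsupp (f : Cn n → ℝ) : ∫ z in D, f z * p z = ∫ z in tsupport ω, f z * p z := by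
      refine (setIntegral_eq_of_subset_of_forall_sdiff_eq_zero hD.measurableSet h3 ?_)
      intro z hz
      rw [show p z = 0 from pairingDensity_eq_zero_of_notMem_tsupport hm hmn v hz.2, mul_zero]
    obtain ⟨C, hC⟩ := h2.isCompact.exists_bound_of_continuousOn hp
    have hF (j : ℕ) : IntegrableOn (fun z => (u j z).toReal * p z) (tsupport ω) :=
      (hint j h3 h2.isCompact).mul_continuousOn hp h2.isCompact
    have hFsum : Summable fun j => ∫ z in tsupport ω, ‖(u j z).toReal * p z‖ := by
      refine .of_nonneg_of_le (fun j => by positivity) (fun j => ?_)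
        ((hsum _ h3 h2.isCompact).mul_right C)
      rw [← integral_mul_const]
      refine setIntegral_mono_on (hF j).norm ((hint j h3 h2.isCompact).norm.mul_const C)
        h2.isCompact.measurableSet fun z hz => ?_
      rw [norm_mul]
      exact mul_le_mul_of_nonneg_left (hC z hz) (norm_nonneg _)
    have hlim := hasSum_integral_of_summable_integral_norm hF hFsum
    have heq : ∫ z in D, (erealSeries fun j => u j z).toReal * p z =
        ∫ z in tsupport ω, ∑' j, (u j z).toReal * p z := by
      rw [hsupp fun z => (erealSeries fun j => u j z).toReal]
      refine integral_congr_ae ?_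
      filter_upwards [ae_restrict_of_ae_restrict_of_subset h3 hae] with z hz
      rw [hz, EReal.toReal_coe, tsum_mul_right]
    rw [heq]
    refine hlim.nonneg fun j => ?_
    rw [← hsupp fun z => (u j z).toReal]
    exact (hu j).current_nonneg v hv ω h1 h2 h3 h4

theorem IsMSubharmonic.exists_le_of_isCompact {u : Cn n → EReal} (hu : IsMSubharmonic hm hmn D u)
    {L : Set (Cn n)} (hLD : L ⊆ D) (hL : IsCompact L) : ∃ M : ℝ, ∀ z ∈ L, u z ≤ M := by
  rcases L.eq_empty_or_nonempty with rfl | hne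
  · exact ⟨0, by simp⟩
  obtain ⟨a, haL, ha⟩ := (hu.upperSemicontinuousOn.mono hLD).exists_isMaxOn hne hL
  exact ⟨(u a).toReal, fun z hz => (ha hz).trans (EReal.le_coe_toReal (hu.ne_top a (hLD haL)))⟩

/-- A small multiple of an `m`-subharmonic function is at most `ε` on a given compact set, both
pointwise (from above) and in `L¹`. -/
theorem IsMSubharmonic.exists_const_mul_le {u : Cn n → EReal} (hu : IsMSubharmonic hm hmn D u)
    {L : Set (Cn n)} (hLD : L ⊆ D) (hL : IsCompact L) {ε : ℝ} (hε : 0 < ε) :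
    ∃ c : ℝ, 0 < c ∧ (∀ z ∈ L, (c : EReal) * u z ≤ (ε : EReal)) ∧
      ∫ z in L, ‖((c : EReal) * u z).toReal‖ ≤ ε := by
  obtain ⟨M, hM⟩ := hu.exists_le_of_isCompact hLD hL
  set I := ∫ z in L, ‖(u z).toReal‖
  have hI : 0 ≤ I := by positivity
  have hpos : 0 < 1 + |M| + I := by positivity
  have hc : 0 < ε / (1 + |M| + I) := by positivity
  refine ⟨ε / (1 + |M| + I), hc, fun z hz => ?_, ?_⟩
  · refine (mul_le_mul_of_nonneg_left (hM z hz) (EReal.coe_nonneg.mpr hc.le)).trans ?_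
    rw [← EReal.coe_mul, EReal.coe_le_coe_iff, div_mul_eq_mul_div, div_le_iff₀ hpos]
    exact mul_le_mul_of_nonneg_left (by linarith [le_abs_self M]) hε.le
  · simp only [EReal.toReal_mul, EReal.toReal_coe, norm_mul, integral_const_mul]
    rw [Real.norm_of_nonneg hc.le, div_mul_eq_mul_div, div_le_iff₀ hpos]
    exact mul_le_mul_of_nonneg_left (by linarith [abs_nonneg M]) hε.le

/-! ### Countable unions -/

theorem exists_compact_exhaustion_of_isOpen {X : Type*} [TopologicalSpace X] [LocallyCompactSpace X]
    [SecondCountableTopology X] {D : Set X} (hD : IsOpen D) :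
    ∃ K : ℕ → Set X, (∀ k, IsCompact (K k) ∧ K k ⊆ D) ∧
      ∀ L ⊆ D, IsCompact L → ∀ᶠ k in atTop, L ⊆ K k := by
  have := hD.locallyCompactSpace
  let K : CompactExhaustion D := default
  refine ⟨fun k => Subtype.val '' K k,
    fun k => ⟨(K.isCompact k).image continuous_subtype_val, Subtype.coe_image_subset _ _⟩,
    fun L hLD hL => ?_⟩
  obtain ⟨k, hk⟩ := K.exists_superset_of_isCompact
    (Topology.IsInducing.subtypeVal.isCompact_preimage' hL (by simpa using hLD))
  filter_upwards [eventually_ge_atTop k] with l hl z hz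
  exact ⟨⟨z, hLD hz⟩, K.subset hl (hk hz), rfl⟩

theorem isMPolar_iUnion_nat (hD : IsOpen D) (hne : D.Nonempty) {E : ℕ → Set (Cn n)}
    (hE : ∀ j, IsMPolar hm hmn D (E j)) : IsMPolar hm hmn D (⋃ j, E j) := by
  choose hED u hu _ hbot using hE
  obtain ⟨K, hK, hKL⟩ := exists_compact_exhaustion_of_isOpen hD
  choose c hc hle hint using fun j => (hu j).exists_const_mul_le (hK j).2 (hK j).1
    (show (0 : ℝ) < (1 / 2) ^ j by positivity)
  have hv (j : ℕ) : IsMSubharmonic hm hmn D fun z => (c j : EReal) * u j z :=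
    (hu j).const_mul (hc j)
  have hser := isMSubharmonic_erealSeries hD hv
    (fun L hLD hL => by
      refine .of_norm_bounded_eventually_nat (g := fun j => (1 / 2 : ℝ) ^ j)
        (summable_geometric_of_lt_one (by norm_num) (by norm_num)) ?_
      filter_upwards [hKL L hLD hL] with j hj
      rw [Real.norm_of_nonneg (by positivity)]
      refine (setIntegral_mono_set ?_ (ae_of_all _ fun _ => norm_nonneg _)
        hj.eventuallyLE).trans (hint j)
      exact ((hv j).locallyIntegrableOn.integrableOn_compact_subset (hK j).2 (hK j).1).norm)
    (fun L hLD hL => by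
      filter_upwards [hKL L hLD hL] with j hj z hz using hle j z (hj hz))
  -- The sum is finite almost everywhere in `D`, and `D` has positive measure.
  refine ⟨iUnion_subset hED, _, hser, ?_, fun z hz => ?_⟩
  · have : NeBot (ae (volume.restrict D)) := by
      rw [ae_neBot, Ne, Measure.restrict_eq_zero]
      exact (hD.measure_pos volume hne).ne'
    obtain ⟨z, hz, hzD⟩ := (hser.ae_ne_bot.and (ae_restrict_mem hD.measurableSet)).exists
    exact ⟨z, hzD, hz⟩
  · obtain ⟨j, hj⟩ := mem_iUnion.mp hz
    refine erealSeries_eq_bot (j := j) ?_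
    rw [hbot j z hj, EReal.coe_mul_bot_of_pos (hc j)]

end ComplexHessian

theorem theorem2 {n m : ℕ} (hm : 1 ≤ m) (hmn : m ≤ n) (D : Set (ComplexHessian.Cn n))
    (hDopen : IsOpen D) (hDconn : IsConnected D) {ι : Type*} [Countable ι]
    (E : ι → Set (ComplexHessian.Cn n))
    (hE : ∀ j, ComplexHessian.IsMPolar hm hmn D (E j)) :
    ComplexHessian.IsMPolar hm hmn D (⋃ j, E j) := by
  -- An empty union is polar because of the zero function.
  rcases isEmpty_or_nonempty ι with hι | hι
  · obtain ⟨z, hz⟩ := hDconn.nonempty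
    rw [Set.iUnion_of_empty]
    exact ⟨Set.empty_subset D, _, ComplexHessian.isMSubharmonic_zero, ⟨z, hz, by simp⟩, by simp⟩
  · obtain ⟨e, he⟩ := exists_surjective_nat ι
    rw [← he.iUnion_comp]
    exact ComplexHessian.isMPolar_iUnion_nat hDopen hDconn.nonempty fun j => hE (e j)
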